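/- A partial word over an alphabet $A$ is a finite sequence of characters from $A\cup\{\diamond\}$, where $\diamond\notin A$ is the hole character; its hole density is its number of holes divided by its (positive) length. Two partial words $u,v$ of equal length are compatible if $u_i=v_i$ whenever $u_i$ and $v_i$ are both letters. A partial word $w$ over $A$ encounters a pattern $p$ (a word over an alphabet $\mathcal V$) if some factor of $w$ is compatible with $\varphi(p)$ for some nonerasing morphism $\varphi:\mathcal V^*\to A^*$; otherwise $w$ avoids $p$. For a rational $d\in(0,1)$ and an integer $m\ge 1$, let $L_d(m,p)$ be the least $n$ such that there are partial words of length $n$ with hole density $d$ over an $m$-letter alphabet and all of them encounter $p$ ($L_d(m,p)=\infty$ if there is no such $n$). For $k\ge 1$ put $$Q(k)=[1+d(m-1)]^{k}-\left(1-\tfrac1m\right)(md)^{k}.$$ (1) Let $p$ be a pattern with $r$ distinct variables, the $j$th of which occurs $k_j\ge 1$ times, ordered so that $1=k_1=\cdots=k_s<k_{s+1}\le\cdots\le k_r$. Let $n\ge 1$ be an integer such that $dn$ is an integer. If $$n<\left[(s+1)!\prod_{j=s+1}^r\left(\frac{m^{k_j-1}}{Q(k_j)}-1\right)\right]^{\frac1{s+1}},$$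 then there is a partial word of length $n$ with hole density $d$ over an $m$-letter alphabet that avoids $p$. (2) For the Zimin patterns $Z_1=a_1$, $Z_i=Z_{i-1}a_iZ_{i-1}$ and every $i\ge 1$, $$L_d(m,Z_i)\ \ge\ \sqrt{2\prod_{j=1}^{i-1}\left(\frac{m^{2^j-1}}{Q(2^j)}-1\right)}.$$ Both bounds hold exactly, for all $m$, $d$, $p$, $n$ and $i$ as above; in particular they hold with an additional factor $1+o(1)$ on the right-hand side (the error term may be taken to be $0$). -/

import Mathlib

noncomputable section

/-- A partial word over the alphabet `A`: a finite sequence of characters from `A + {hole}`,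
where `none` is the hole character. -/
abbrev PartialWord (A : Type*) := List (Option A)

namespace PartialWord

/-- The number of holes divided by the length. (A partial word of length `0` has no hole density;
the value is then `0` by convention, while only densities `d > 0` are considered below.) -/
def holeDensity {A : Type*} (w : PartialWord A) : ℚ :=
  (w.countP fun c => c.isNone : ℚ) / (w.length : ℚ)

/-- `u ↑ v`: equal lengths, and `u_i = v_i` whenever `u_i` and `v_i` are both letters. -/
def Compatible {A : Type*} (u v : PartialWord A) : Prop :=
  List.Forall₂ (fun a b => ∀ x ∈ a, ∀ y ∈ b, x = y) u v

/-- `w` encounters the pattern `p`: some factor `f` of `w` is compatible with `φ(p)` for some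
nonerasing morphism `φ : V* → A*`. A morphism of free monoids is given by the images of the
letters, `p.flatMap φ` is the image of `p`, and `φ` is nonerasing when no letter has an empty
image. -/
def Encounters {A V : Type*} (w : PartialWord A) (p : List V) : Prop :=
  ∃ φ : V → List A, (∀ v, φ v ≠ []) ∧
    ∃ f : PartialWord A, f <:+: w ∧ Compatible f ((p.flatMap φ).map some)

def Avoids {A V : Type*} (w : PartialWord A) (p : List V) : Prop :=
  ¬ Encounters w p

end PartialWord

/-- `L_d(m, p)`: the least `n` such that there are partial words of length `n` with hole density
`d` over `m` letters and all of them encounter `p` (`⊤` if there is no such `n`). -/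
def partialRamseyLength {V : Type*} (d : ℚ) (m : ℕ) (p : List V) : ℕ∞ :=
  sInf {N : ℕ∞ | ∃ n : ℕ, N = n ∧
    (∃ w : PartialWord (Fin m), w.length = n ∧ w.holeDensity = d) ∧
    ∀ w : PartialWord (Fin m), w.length = n → w.holeDensity = d → w.Encounters p}

/-- The Zimin patterns `Z_1 = a_1`, `Z_{i+1} = Z_i a_{i+1} Z_i` (with `Z_0` empty); the variable
`a_i` is the natural number `i`. -/
def zimin : ℕ → List ℕ
  | 0 => []
  | i + 1 => zimin i ++ [i + 1] ++ zimin i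

/-- `Q = [1 + d(m-1)]^k - (1 - 1/m)(md)^k`. -/
def patternQ (m : ℕ) (d : ℚ) (k : ℕ) : ℝ :=
  (1 + (d : ℝ) * ((m : ℝ) - 1)) ^ k - (1 - 1 / (m : ℝ)) * ((m : ℝ) * (d : ℝ)) ^ k

/-- `s`: the number of variables that occur exactly once in `p`. -/
def numSingle {V : Type*} [DecidableEq V] (p : List V) : ℕ :=
  (p.toFinset.filter fun v => p.count v = 1).card

/-- `[(s+1)! ∏ (m^(k_v - 1) / Q_v - 1)]^(1/(s+1))`, the product being over the variables `v` of `p`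
that occur `k_v ≥ 2` times. -/
def avoidThreshold {V : Type*} [DecidableEq V] (m : ℕ) (d : ℚ) (p : List V) : ℝ :=
  (((numSingle p + 1).factorial : ℝ) *
    ∏ v ∈ p.toFinset.filter (fun v => 2 ≤ p.count v),
      ((m : ℝ) ^ (p.count v - 1) / patternQ m d (p.count v) - 1)) ^
    (1 / ((numSingle p : ℝ) + 1))

end

/-! The proof is a first-moment argument over the uniform distribution on words of length `n` with
exactly `h = dn` holes. Fix the starting point and the lengths `ℓ v` of the images of the variables.
An occurrence then says that, for each variable `v` and each `q < ℓ v`, the positions carrying the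
`q`-th letter of the image of `v` are constant up to holes. Such a class has as many elements as `v`
has occurrences, so variables occurring once impose no condition.

If characters were independent, a class of size `k` would be constant up to holes with probability
`constProb m d k`, which is `Q(k) / m^(k-1)`. With the number of holes fixed, prescribing `L`
positions costs at most an extra factor `n / (n + 1 - L)` (`choose_sub_mul_pow_le`,
`card_words_constUpToHoles_le`).

This loss disappears in the union bound. For given lengths of the repeated variables, occupying `L`
positions in all, the start and the `s` single lengths can be chosen in at most `(n + 1 - L).choose
(s + 1)` ways, and this times `n / (n + 1 - L)` is at most `n^(s+1) / (s+1)!`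
(`choose_mul_factorial_le`). Summing a geometric series for each repeated variable
(`card_encounters_le`) gives an expected count below `1` under the hypothesis, with no error term.
The bound for Zimin patterns is the case `s = 1`. -/

/-! ### Sampling without replacement against independent sampling. -/

theorem sub_mul_le_sub_mul_of_mul_le {h g j i : ℕ} (hc : i * (h + 1) ≤ (j + 1) * (g + 1)) :
    (h - j) * (h + g + 2) ≤ (h + g + 1 - (j + i)) * (h + 1) := by
  rw [Nat.sub_mul, Nat.sub_mul]
  have : h * (h + g + 2) + (j + i) * (h + 1) ≤ (h + g + 1) * (h + 1) + j * (h + g + 2) := by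
    nlinarith
  omega

/-- Sampling without replacement is controlled by sampling with replacement, the first draw of
each kind being left out. -/
theorem descFactorial_mul_descFactorial_mul_pow_le (h g : ℕ) : ∀ L j i : ℕ, j + i = L →
    h.descFactorial j * g.descFactorial i * (h + g + 2) ^ L ≤
      (h + g + 1).descFactorial L * ((h + 1) ^ j * (g + 1) ^ i) := by
  intro L
  induction L with
  | zero =>
    intro j i hji
    obtain ⟨rfl, rfl⟩ : j = 0 ∧ i = 0 := by omega
    simp
  | succ L ih =>
    intro j i hji
    -- The order of the draws is free, so the last one is taken from the kind that exceeds its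
    -- share. Its conditional probability without replacement is then at most the one with
    -- replacement.
    rcases Nat.lt_or_ge (j * (g + 1)) (i * (h + 1)) with hc | hc
    · obtain ⟨i, rfl⟩ := Nat.exists_eq_succ_of_ne_zero (n := i) (by rintro rfl; simp at hc)
      have h1 := ih j i (by omega)
      have h2 := sub_mul_le_sub_mul_of_mul_le hc.le
      rw [add_comm g h, add_comm i j, show j + i = L by omega] at h2
      rw [Nat.descFactorial_succ, Nat.descFactorial_succ, pow_succ, pow_succ]
      calc _ = (h.descFactorial j * g.descFactorial i * (h + g + 2) ^ L) *
              ((g - i) * (h + g + 2)) := by ring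
        _ ≤ _ := Nat.mul_le_mul h1 h2
        _ = _ := by ring
    · obtain ⟨j, rfl⟩ := Nat.exists_eq_succ_of_ne_zero (n := j) (by
        rintro rfl
        have : i = 0 := by simpa using hc
        omega)
      have h1 := ih j i (by omega)
      have h2 := sub_mul_le_sub_mul_of_mul_le hc
      rw [show j + i = L by omega] at h2
      rw [Nat.descFactorial_succ, Nat.descFactorial_succ, pow_succ, pow_succ]
      calc _ = (h.descFactorial j * g.descFactorial i * (h + g + 2) ^ L) *
              ((h - j) * (h + g + 2)) := by ring
        _ ≤ _ := Nat.mul_le_mul h1 h2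
        _ = _ := by ring

/-- The preceding bound is applied to `h - 1` and `g - 1` after splitting off a first draw of each
kind that occurs. When both occur, only `L - 2` draws remain, where `L = j + i`, so the last factor
`n + 1 - L` of the falling factorial of `n = h + g` stays unmatched; this is the origin of the loss.
When one kind occurs, `n + 1 - L ≤ n` suffices. -/
theorem descFactorial_mul_pow_le {h g j i : ℕ} (hh : 0 < h) (hg : 0 < g) (hL : 0 < j + i) :
    h.descFactorial j * g.descFactorial i * (h + g) ^ (j + i) * (h + g + 1 - (j + i)) ≤
      (h + g) * (h + g).descFactorial (j + i) * (h ^ j * g ^ i) := by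
  obtain ⟨h, rfl⟩ := Nat.exists_eq_add_of_le' hh
  obtain ⟨g, rfl⟩ := Nat.exists_eq_add_of_le' hg
  have en : h + 1 + (g + 1) = h + g + 1 + 1 := by ring
  rw [en]
  have aux : ∀ j i : ℕ, (h + 1).descFactorial (j + 1) * g.descFactorial i *
      (h + g + 2) ^ (j + i + 1) * (h + g + 1 + 1 + 1 - (j + 1 + i)) ≤
      (h + g + 1 + 1) * (h + g + 1 + 1).descFactorial (j + i + 1) *
        ((h + 1) ^ (j + 1) * (g + 1) ^ i) := by
    intro j i
    have h1 := descFactorial_mul_descFactorial_mul_pow_le h g (j + i) j i rfl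
    rw [Nat.succ_descFactorial_succ, Nat.succ_descFactorial_succ]
    calc _ = (h.descFactorial j * g.descFactorial i * (h + g + 2) ^ (j + i)) *
          ((h + 1) * (h + g + 2) * (h + g + 1 + 1 + 1 - (j + 1 + i))) := by ring
      _ ≤ ((h + g + 1).descFactorial (j + i) * ((h + 1) ^ j * (g + 1) ^ i)) *
          ((h + 1) * (h + g + 2) * (h + g + 1 + 1)) := by
        gcongr; omega
      _ = _ := by ring
  have aux' : ∀ j i : ℕ, h.descFactorial j * (g + 1).descFactorial (i + 1) *
      (h + g + 2) ^ (j + i + 1) * (h + g + 1 + 1 + 1 - (j + 1 + i)) ≤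
      (h + g + 1 + 1) * (h + g + 1 + 1).descFactorial (j + i + 1) *
        ((h + 1) ^ j * (g + 1) ^ (i + 1)) := by
    intro j i
    have h1 := descFactorial_mul_descFactorial_mul_pow_le h g (j + i) j i rfl
    rw [Nat.succ_descFactorial_succ, Nat.succ_descFactorial_succ]
    calc _ = (h.descFactorial j * g.descFactorial i * (h + g + 2) ^ (j + i)) *
          ((g + 1) * (h + g + 2) * (h + g + 1 + 1 + 1 - (j + 1 + i))) := by ring
      _ ≤ ((h + g + 1).descFactorial (j + i) * ((h + 1) ^ j * (g + 1) ^ i)) *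
          ((g + 1) * (h + g + 2) * (h + g + 1 + 1)) := by
        gcongr; omega
      _ = _ := by ring
  rcases j with _ | j
  · rcases i with _ | i
    · simp at hL
    · simpa [add_comm, add_left_comm] using aux' 0 i
  · rcases i with _ | i
    · simpa using aux j 0
    · have h1 := descFactorial_mul_descFactorial_mul_pow_le h g (j + i) j i rfl
      have e1 : j + 1 + (i + 1) = j + i + 1 + 1 := by ring
      rw [e1, Nat.descFactorial_succ (h + g + 1 + 1), Nat.succ_descFactorial_succ (h + g + 1),
        Nat.succ_descFactorial_succ, Nat.succ_descFactorial_succ]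
      have e2 : h + g + 1 + 1 + 1 - (j + i + 1 + 1) = h + g + 1 + 1 - (j + i + 1) := by omega
      rw [e2]
      calc _ = (h.descFactorial j * g.descFactorial i * (h + g + 2) ^ (j + i)) *
            ((h + 1) * (g + 1) * (h + g + 2) ^ 2 * (h + g + 1 + 1 - (j + i + 1))) := by ring
        _ ≤ ((h + g + 1).descFactorial (j + i) * ((h + 1) ^ j * (g + 1) ^ i)) *
            ((h + 1) * (g + 1) * (h + g + 2) ^ 2 * (h + g + 1 + 1 - (j + i + 1))) := by gcongr
        _ = _ := by ring

theorem choose_mul_descFactorial_mul (h g j i : ℕ) (hj : j ≤ h) (hi : i ≤ g) :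
    (h + g).choose h * (h.descFactorial j * g.descFactorial i) =
      (h + g - (j + i)).choose (h - j) * (h + g).descFactorial (j + i) := by
  obtain ⟨a, rfl⟩ := Nat.exists_eq_add_of_le hj
  obtain ⟨b, rfl⟩ := Nat.exists_eq_add_of_le hi
  have e : j + a + (i + b) - (j + i) = a + b := by omega
  have e' : j + a - j = a := by omega
  rw [e, e']
  have h1 := Nat.factorial_mul_descFactorial hj
  have h2 := Nat.factorial_mul_descFactorial hi
  have h3 := Nat.factorial_mul_descFactorial (n := j + a + (i + b)) (k := j + i) (by omega)
  have h4 := Nat.add_choose_mul_factorial_mul_factorial (j + a) (i + b)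
  have h5 := Nat.add_choose_mul_factorial_mul_factorial a b
  rw [← Nat.choose_symm_add] at h4 h5
  rw [e'] at h1
  rw [e] at h3
  rw [Nat.add_sub_cancel_left] at h2
  apply Nat.eq_of_mul_eq_mul_right (Nat.mul_pos a.factorial_pos b.factorial_pos)
  calc _ = (j + a + (i + b)).choose (j + a) * (a.factorial * (j + a).descFactorial j) *
        (b.factorial * (i + b).descFactorial i) := by ring
    _ = (a + b).factorial * (j + a + (i + b)).descFactorial (j + i) := by rw [h1, h2, h4, h3]
    _ = _ := by rw [← h5]; ring

/-- Prescribing `j` holes and `i` letters is at most `n / (n + 1 - (j + i))` times as likely for a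
uniform arrangement of `h` holes and `g` letters as for independent holes of the same density. -/
theorem choose_sub_mul_pow_le {h g j i : ℕ} (hh : 0 < h) (hg : 0 < g) (hL : 0 < j + i)
    (hj : j ≤ h) (hi : i ≤ g) :
    (h + g - (j + i)).choose (h - j) * ((h + g) ^ (j + i) * (h + g + 1 - (j + i))) ≤
      (h + g).choose h * ((h + g) * (h ^ j * g ^ i)) := by
  have h1 := descFactorial_mul_pow_le (j := j) (i := i) hh hg hL
  have h2 := choose_mul_descFactorial_mul h g j i hj hi
  have h3 : 0 < (h + g).descFactorial (j + i) := Nat.descFactorial_pos.2 (by omega)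
  apply Nat.le_of_mul_le_mul_right _ h3
  calc _ = (h + g - (j + i)).choose (h - j) * (h + g).descFactorial (j + i) *
        ((h + g) ^ (j + i) * (h + g + 1 - (j + i))) := by ring
    _ = (h + g).choose h * (h.descFactorial j * g.descFactorial i * (h + g) ^ (j + i) *
          (h + g + 1 - (j + i))) := by rw [← h2]; ring
    _ ≤ (h + g).choose h * ((h + g) * (h + g).descFactorial (j + i) * (h ^ j * g ^ i)) := by
        gcongr
    _ = _ := by ring

/-! ### Counting words with a fixed number of holes. -/

/-- The weight of a character when holes have density `d` and letters are uniform. -/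
noncomputable def charWeight {A : Type*} [Fintype A] (d : ℝ) : Option A → ℝ
  | none => d
  | some _ => (1 - d) / Fintype.card A

open Finset in
/-- The partial words with `h` holes, indexed by `T`. -/
def wordsWithHoles (T A : Type*) [Fintype T] [DecidableEq T] [Fintype A] [DecidableEq A]
    (h : ℕ) : Finset (T → Option A) :=
  {w | #{t | w t = none} = h}

section Counting

open Finset

variable {T A : Type*} [Fintype T] [DecidableEq T] [Fintype A] [DecidableEq A]

theorem mem_wordsWithHoles {h : ℕ} {w : T → Option A} :
    w ∈ wordsWithHoles T A h ↔ #{t | w t = none} = h := by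
  simp [wordsWithHoles]

-- Generating function in which `X` marks a hole: a prescribed position contributes `X` or `1`, a
-- free one `X + |A|`.
open Polynomial in
theorem card_words_prescribed_eq_coeff (h : ℕ) (S : Finset T) (u : T → Option A) :
    #{w ∈ wordsWithHoles T A h | ∀ t ∈ S, w t = u t} =
      ((X : ℕ[X]) ^ #{t ∈ S | u t = none} *
        (X + C (Fintype.card A)) ^ (Fintype.card T - #S)).coeff h := by
  let f : Option A → ℕ[X] := fun a => if a = none then X else 1
  have h1 := Finset.prod_univ_sum (fun t : T => if t ∈ S then {u t} else (univ : Finset (Option A)))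
    (fun _ a => f a)
  have hl : ∏ t : T, ∑ a ∈ (if t ∈ S then {u t} else (univ : Finset (Option A))), f a =
      X ^ #{t ∈ S | u t = none} * (X + C (Fintype.card A)) ^ (Fintype.card T - #S) := by
    rw [← Finset.prod_mul_prod_compl S]
    congr 1
    · rw [Finset.prod_congr rfl (g := fun t => f (u t)) (fun t ht => by simp [ht]),
        Finset.prod_ite, Finset.prod_const, Finset.prod_const_one, mul_one]
    · rw [Finset.prod_congr rfl (g := fun _ => X + C (Fintype.card A)) (fun t ht => by
        rw [Finset.mem_compl] at ht
        simp [ht, f, Fintype.sum_option]), Finset.prod_const, Finset.card_compl]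
  have hr : ∀ w : T → Option A, ∏ t, f (w t) = X ^ #{t | w t = none} := fun w => by
    rw [Finset.prod_ite, Finset.prod_const, Finset.prod_const_one, mul_one]
  rw [← hl, h1, Polynomial.finsetSum_coeff]
  simp_rw [hr, Polynomial.coeff_X_pow]
  rw [Finset.sum_boole]
  simp only [Nat.cast_id]
  congr 1
  ext w
  simp only [mem_filter, mem_wordsWithHoles, Fintype.mem_piFinset]
  constructor
  · rintro ⟨hw, hS⟩
    refine ⟨fun t => ?_, hw.symm⟩
    split_ifs with ht
    · simpa using hS t ht
    · simp
  · rintro ⟨hS, hw⟩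
    refine ⟨hw.symm, fun t ht => ?_⟩
    have := hS t
    rw [if_pos ht] at this
    simpa using this

theorem card_wordsWithHoles (h : ℕ) :
    #(wordsWithHoles T A h) =
      Fintype.card A ^ (Fintype.card T - h) * (Fintype.card T).choose h := by
  have := card_words_prescribed_eq_coeff (T := T) (A := A) h ∅ fun _ => none
  rw [Polynomial.coeff_X_pow_mul', Polynomial.coeff_X_add_C_pow] at this
  simpa using this

theorem card_words_prescribed_le [Nonempty A] {h : ℕ} (h0 : 0 < h) (hn : h < Fintype.card T)
    {S : Finset T} (hS : S.Nonempty) (u : T → Option A) :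
    (#{w ∈ wordsWithHoles T A h | ∀ t ∈ S, w t = u t} : ℝ) * (Fintype.card T + 1 - #S) ≤
      #(wordsWithHoles T A h) * Fintype.card T *
        ∏ t ∈ S, charWeight ((h : ℝ) / Fintype.card T) (u t) := by
  obtain ⟨g, hg⟩ := Nat.exists_eq_add_of_lt hn
  set n := Fintype.card T with hndef
  set m := Fintype.card A with hmdef
  set j := #{t ∈ S | u t = none} with hj
  set i := #{t ∈ S | ¬ u t = none} with hi
  have hm : (0 : ℝ) < m := by exact_mod_cast Fintype.card_pos
  have hn0 : (0 : ℝ) < n := by exact_mod_cast (by omega : 0 < n)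
  have hji : j + i = #S := Finset.card_filter_add_card_filter_not _
  have hSn : #S ≤ n := Finset.card_le_univ S
  have hprod : ∏ t ∈ S, charWeight (A := A) ((h : ℝ) / n) (u t) =
      ((h : ℝ) / n) ^ j * ((1 - (h : ℝ) / n) / m) ^ i := by
    rw [← Finset.prod_filter_mul_prod_filter_not S (fun t => u t = none)]
    congr 1
    · refine Finset.prod_eq_pow_card fun t ht => ?_
      rw [(Finset.mem_filter.1 ht).2]; rfl
    · refine Finset.prod_eq_pow_card fun t ht => ?_
      obtain ⟨a, ha⟩ := Option.ne_none_iff_exists'.1 (Finset.mem_filter.1 ht).2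
      rw [ha]; rfl
  have hW : (0 : ℝ) ≤ #(wordsWithHoles T A h) * n *
      ∏ t ∈ S, charWeight (A := A) ((h : ℝ) / n) (u t) := by
    rw [hprod]
    have : (h : ℝ) / n ≤ 1 := by
      rw [div_le_one hn0]; exact_mod_cast hn.le
    have : 0 ≤ 1 - (h : ℝ) / n := by linarith
    positivity
  rw [card_words_prescribed_eq_coeff, Polynomial.coeff_X_pow_mul', ← hj]
  split_ifs with hjh
  swap
  · simpa using hW
  rw [Polynomial.coeff_X_add_C_pow]
  simp only [Nat.cast_id]
  -- If the free positions cannot hold the remaining holes, no word fits. Otherwise at most `n - h =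
  -- g + 1` letters are prescribed.
  rcases Nat.lt_or_ge (n - #S) (h - j) with hlt | hge
  · rw [Nat.choose_eq_zero_of_lt hlt]
    simpa using hW
  have hig : i ≤ g + 1 := by omega
  have key := choose_sub_mul_pow_le (h := h) (g := g + 1) (j := j) (i := i) h0 (by omega)
    (by rw [hji]; exact hS.card_pos) hjh hig
  rw [hji, show h + (g + 1) = n by omega] at key
  have key' : ((n - #S).choose (h - j) : ℝ) * ((n : ℝ) ^ #S * (n + 1 - #S)) ≤
      n.choose h * (n * ((h : ℝ) ^ j * ((n : ℝ) - h) ^ i)) := by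
    have e : ((g + 1 : ℕ) : ℝ) = n - h := by rw [hg]; push_cast; ring
    have := (Nat.cast_le (α := ℝ)).2 key
    rw [Nat.cast_mul, Nat.cast_mul, Nat.cast_sub (by omega), Nat.cast_mul, Nat.cast_mul,
      Nat.cast_mul, Nat.cast_pow, Nat.cast_pow, Nat.cast_pow, e] at this
    exact_mod_cast this
  rw [hprod, card_wordsWithHoles, ← hndef, ← hmdef]
  have e1 : n - #S - (h - j) + i = n - h := by omega
  have e2 : (1 - (h : ℝ) / n) / m = (n - h) / (n * m) := by field_simp
  rw [e2, ← e1, div_pow, div_pow, mul_pow, pow_add]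
  push_cast
  have e3 : ((m : ℝ) ^ (n - #S - (h - j)) * (m : ℝ) ^ i * (n.choose h) * n *
      ((h : ℝ) ^ j / (n : ℝ) ^ j * (((n : ℝ) - h) ^ i / ((n : ℝ) ^ i * (m : ℝ) ^ i)))) =
      (m : ℝ) ^ (n - #S - (h - j)) *
        (n.choose h * (n * ((h : ℝ) ^ j * ((n : ℝ) - h) ^ i))) / (n : ℝ) ^ #S := by
    rw [← hji, pow_add]
    field_simp
  rw [e3, le_div_iff₀ (by positivity)]
  calc _ = (m : ℝ) ^ (n - #S - (h - j)) *
        (((n - #S).choose (h - j) : ℝ) * ((n : ℝ) ^ #S * (n + 1 - #S))) := by ring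
    _ ≤ _ := by gcongr

/-- A finite family of characters is constant up to holes. -/
def ConstUpToHoles {F A : Type*} (v : F → Option A) : Prop :=
  ∃ a, ∀ i, v i = none ∨ v i = some a

-- The all-hole family is counted once, with weight `d ^ k`. The others split according to their
-- unique letter `a`: they are the families over `{none, some a}` that are not all holes.
open Classical in
theorem sum_constUpToHoles_le [Nonempty A] {F : Type*} [Fintype F] [DecidableEq F] {d : ℝ}
    (hd0 : 0 ≤ d) (hd1 : d ≤ 1) :
    ∑ v : F → Option A with ConstUpToHoles v, ∏ i, charWeight d (v i) ≤
      d ^ Fintype.card F + Fintype.card A *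
        ((d + (1 - d) / Fintype.card A) ^ Fintype.card F - d ^ Fintype.card F) := by
  have hw : ∀ v : F → Option A, 0 ≤ ∏ i, charWeight d (v i) := fun v => by
    refine Finset.prod_nonneg fun i _ => ?_
    have : 0 ≤ 1 - d := by linarith
    cases v i <;> simp only [charWeight] <;> positivity
  let z : F → Option A := fun _ => none
  let B : A → Finset (F → Option A) := fun a => Fintype.piFinset fun _ => {none, some a}
  have hsub : ({v : F → Option A | ConstUpToHoles v} : Finset _) ⊆
      {z} ∪ univ.biUnion fun a => B a \ {z} := by
    intro v hv
    obtain ⟨a, ha⟩ := (Finset.mem_filter.1 hv).2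
    simp only [Finset.mem_union, Finset.mem_singleton, Finset.mem_biUnion, Finset.mem_univ,
      true_and, Finset.mem_sdiff]
    by_cases hz : v = z
    · exact Or.inl hz
    · exact Or.inr ⟨a, by simpa [B] using ha, hz⟩
  have hz : ∏ i, charWeight d (z i) = d ^ Fintype.card F := by
    simp [z, charWeight]
  have hB : ∀ a, ∑ v ∈ B a \ {z}, ∏ i, charWeight d (v i) =
      (d + (1 - d) / Fintype.card A) ^ Fintype.card F - d ^ Fintype.card F := fun a => by
    have h1 := Finset.prod_univ_sum (fun _ : F => ({none, some a} : Finset (Option A)))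
      (fun _ c => charWeight d c)
    rw [Finset.sum_pair (by simp), Finset.prod_const, Finset.card_univ] at h1
    rw [Finset.sum_sdiff_eq_sub (by simp [B, z]), Finset.sum_singleton, hz, ← h1]
    rfl
  calc _ ≤ _ := Finset.sum_le_sum_of_subset_of_nonneg hsub fun v _ _ => hw v
    _ ≤ ∑ v ∈ {z}, ∏ i, charWeight d (v i) +
        ∑ v ∈ univ.biUnion fun a => B a \ {z}, ∏ i, charWeight d (v i) := by
      rw [← Finset.sum_union_inter]
      exact le_add_of_nonneg_right (Finset.sum_nonneg fun v _ => hw v)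
    _ ≤ d ^ Fintype.card F + ∑ a, ∑ v ∈ B a \ {z}, ∏ i, charWeight d (v i) := by
      rw [Finset.sum_singleton, hz]
      gcongr
      refine (Finset.sum_biUnion fun a _ b _ hab => Finset.disjoint_left.2 fun v ha hb => ?_).le
      simp only [Finset.mem_sdiff, Finset.mem_singleton, B, Fintype.mem_piFinset,
        Finset.mem_insert] at ha hb
      refine ha.2 (funext fun i => (ha.1 i).elim id fun h1 => (hb.1 i).elim id fun h2 => ?_)
      exact absurd (Option.some_injective _ (h1.symm.trans h2)) hab
    _ = _ := by simp only [hB, Finset.sum_const, Finset.card_univ, nsmul_eq_mul]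

-- Independence of disjoint classes under the product weight.
omit [DecidableEq A] in
open Classical in
theorem sum_prod_constUpToHoles {C : Type*} [Fintype C] [DecidableEq C] {F : C → Type*}
    [∀ c, Fintype (F c)] [∀ c, DecidableEq (F c)] (f : Option A → ℝ) :
    ∑ u : (Σ c, F c) → Option A with ∀ c, ConstUpToHoles fun i => u ⟨c, i⟩, ∏ i, f (u i) =
      ∏ c, ∑ v : F c → Option A with ConstUpToHoles v, ∏ i, f (v i) := by
  rw [Finset.prod_univ_sum]
  refine Finset.sum_bij' (fun u _ c i => u ⟨c, i⟩) (fun v _ i => v i.1 i.2) ?_ ?_ ?_ ?_ ?_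
  · intro u hu
    simpa using hu
  · intro v hv
    simpa using hv
  · intros; rfl
  · intros; rfl
  · intro u _
    rw [Fintype.prod_sigma]

open Classical in
/-- The main estimate: the proportion of the words with `h` holes that are constant up to holes on
each of the disjoint classes of positions `F c`. -/
theorem card_words_constUpToHoles_le [Nonempty A] {h : ℕ} (h0 : 0 < h) (hn : h < Fintype.card T)
    {C : Type*} [Fintype C] [DecidableEq C] {F : C → Type*} [∀ c, Fintype (F c)]
    [∀ c, DecidableEq (F c)] (e : (Σ c, F c) ↪ T) (hne : Nonempty (Σ c, F c)) :
    (#{w ∈ wordsWithHoles T A h | ∀ c, ConstUpToHoles fun i => w (e ⟨c, i⟩)} : ℝ) *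
        (Fintype.card T + 1 - Fintype.card (Σ c, F c)) ≤
      #(wordsWithHoles T A h) * Fintype.card T *
        ∏ c, ∑ v : F c → Option A with ConstUpToHoles v,
          ∏ i, charWeight ((h : ℝ) / Fintype.card T) (v i) := by
  rw [← sum_prod_constUpToHoles, Finset.mul_sum]
  -- The words are sorted by their restriction to the classes, and each restriction is a
  -- prescription on the range of `e`. The value `none` given below to positions off that range
  -- plays no role.
  rw [Finset.card_eq_sum_card_fiberwise (f := fun w i => w (e i))
    (t := {u : (Σ c, F c) → Option A | ∀ c, ConstUpToHoles fun i => u ⟨c, i⟩})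
    (fun w hw => by simpa using (Finset.mem_filter.1 hw).2)]
  rw [Nat.cast_sum, Finset.sum_mul]
  refine Finset.sum_le_sum fun u hu => ?_
  have key := card_words_prescribed_le (T := T) (A := A) h0 hn (S := univ.map e)
    (by simp) (Function.extend e u fun _ => none)
  rw [Finset.prod_map, Finset.card_map, Finset.card_univ] at key
  simp only [e.injective.extend_apply] at key
  refine le_trans (mul_le_mul_of_nonneg_right ?_ ?_) key
  · rw [Nat.cast_le]
    refine Finset.card_le_card fun w hw => ?_
    simp only [Finset.mem_filter] at hw ⊢
    refine ⟨hw.1.1, fun t ht => ?_⟩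
    obtain ⟨i, -, rfl⟩ := Finset.mem_map.1 ht
    rw [e.injective.extend_apply, ← hw.2]
  · have : Fintype.card (Σ c, F c) ≤ Fintype.card T := Fintype.card_le_of_embedding e
    have : (Fintype.card (Σ c, F c) : ℝ) ≤ Fintype.card T := by exact_mod_cast this
    linarith

end Counting

/-! ### Occurrences of a pattern as labelled positions. -/

section Labels

open Finset

theorem sum_range_choose_eq (s M : ℕ) :
    ∑ b ∈ range M, b.choose s = M.choose (s + 1) := by
  induction M with
  | zero => simp
  | succ M ih => rw [Finset.sum_range_succ, ih, Nat.choose_succ_succ, add_comm]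

/-- Induction on `s`: fixing the first value leaves a budget `b < M` for the others, and the
hockey-stick identity sums the resulting binomials. -/
theorem card_fin_functions_sum_le (s : ℕ) : ∀ (M : ℕ) (P : Finset (Fin s → ℕ)),
    (∀ g ∈ P, (∀ v, 1 ≤ g v) ∧ ∑ v, g v ≤ M) → #P ≤ M.choose s := by
  induction s with
  | zero =>
    intro M P _
    simpa using Finset.card_le_univ P
  | succ s ih =>
    intro M P hP
    rw [Finset.card_eq_sum_card_fiberwise (f := fun g => M - g 0) (t := range M),
      ← sum_range_choose_eq]
    · refine Finset.sum_le_sum fun b hb => ?_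
      rw [← Finset.card_image_of_injOn (f := Fin.tail)]
      · refine ih b _ fun g hg => ?_
        obtain ⟨g, hgP, rfl⟩ := Finset.mem_image.1 hg
        rw [Finset.mem_filter] at hgP
        obtain ⟨h1, h2⟩ := hP g hgP.1
        refine ⟨fun v => h1 _, ?_⟩
        rw [Fin.sum_univ_succ] at h2
        change ∑ v : Fin s, g v.succ ≤ b
        omega
      · intro g hg g' hg' h
        simp only [coe_filter, Set.mem_ofPred_eq] at hg hg'
        have h1 := (hP g hg.1).2
        have h2 := (hP g' hg'.1).2
        rw [Fin.sum_univ_succ] at h1 h2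
        rw [← Fin.cons_self_tail g, ← Fin.cons_self_tail g', h, show g 0 = g' 0 by omega]
    · intro g hg
      obtain ⟨h1, h2⟩ := hP g hg
      have := h1 0
      rw [Fin.sum_univ_succ] at h2
      simp only [coe_range, Set.mem_Iio]
      omega

theorem card_functions_sum_le {σ : Type*} [Fintype σ] (M : ℕ) (P : Finset (σ → ℕ))
    (hP : ∀ g ∈ P, (∀ v, 1 ≤ g v) ∧ ∑ v, g v ≤ M) : #P ≤ M.choose (Fintype.card σ) := by
  classical
  let e := Fintype.equivFin σ
  rw [← Finset.card_image_of_injective P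
    (f := fun g => g ∘ e.symm) (e.symm.surjective.injective_comp_right)]
  refine card_fin_functions_sum_le _ M _ fun g hg => ?_
  obtain ⟨g, hgP, rfl⟩ := Finset.mem_image.1 hg
  obtain ⟨h1, h2⟩ := hP g hgP
  refine ⟨fun v => h1 _, ?_⟩
  rwa [← Equiv.sum_comp e.symm] at h2

/-- The factor `n + 1 - L` comes out of the binomial coefficient and pays for the loss `n / (n + 1 -
L)`. What remains is a falling factorial of `n - L` with `s` factors, at most `n ^ s`. -/
theorem choose_mul_factorial_le {n L s : ℕ} (hL : 0 < L) :
    (n + 1 - L).choose (s + 1) * n * (s + 1).factorial ≤ n ^ (s + 1) * (n + 1 - L) := by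
  rcases Nat.lt_or_ge n L with h | h
  · simp [Nat.sub_eq_zero_of_le h]
  · rw [show n + 1 - L = n - L + 1 by omega]
    calc _ = n * ((s + 1).factorial * (n - L + 1).choose (s + 1)) := by ring
      _ = n * ((n - L + 1) * (n - L).descFactorial s) := by
        rw [← Nat.descFactorial_eq_factorial_mul_choose, Nat.succ_descFactorial_succ]
      _ ≤ n * ((n - L + 1) * n ^ s) := by
        gcongr
        exact (Nat.descFactorial_le_pow _ _).trans (Nat.pow_le_pow_left (by omega) _)
      _ = _ := by ring

theorem card_getElem?_eq_some {X : Type*} [DecidableEq X] {l : List X} {n : ℕ}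
    (hl : l.length = n) (x : X) :
    Fintype.card {t : Fin n // l[t.1]? = some x} = l.count x := by
  have := Fin.card_filter_univ_eq_vector_get_eq_count x (⟨l, hl⟩ : List.Vector X n)
  rw [List.Vector.toList_mk] at this
  rw [← this, Fintype.card_subtype]
  subst hl
  refine congrArg _ (Finset.filter_congr fun t _ => ?_)
  simp [List.Vector.get]

variable {V : Type*} [DecidableEq V]

omit [DecidableEq V] in
/-- The image of `p` under the morphism that maps `v` to `(v,0) (v,1) ⋯ (v,ℓ v - 1)`. -/
def labels (p : List V) (ℓ : V → ℕ) : List (V × ℕ) :=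
  p.flatMap fun v => (List.range (ℓ v)).map fun q => (v, q)

omit [DecidableEq V] in
theorem labels_congr {p : List V} {ℓ ℓ' : V → ℕ} (h : ∀ v ∈ p, ℓ v = ℓ' v) :
    labels p ℓ = labels p ℓ' :=
  List.flatMap_congr fun v hv => by rw [h v hv]

theorem length_labels (p : List V) (ℓ : V → ℕ) :
    (labels p ℓ).length = ∑ v ∈ p.toFinset, p.count v * ℓ v := by
  rw [labels, List.length_flatMap]
  simp only [List.length_map, List.length_range]
  rw [Finset.sum_list_map_count]
  simp

theorem count_labels (p : List V) (ℓ : V → ℕ) {v : V} {q : ℕ} (hq : q < ℓ v) :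
    (labels p ℓ).count (v, q) = p.count v := by
  rw [labels, List.count_flatMap]
  induction p with
  | nil => simp
  | cons x p ih =>
    rw [List.map_cons, List.sum_cons, ih, List.count_cons, add_comm]
    congr 1
    by_cases hx : x = v
    · subst hx
      simp only [Function.comp, beq_self_eq_true, if_true]
      rw [List.count_map_of_injective _ _ (fun a b h => by simpa using h)]
      exact List.count_eq_one_of_mem List.nodup_range (List.mem_range.2 hq)
    · simp only [Function.comp, beq_iff_eq, hx, if_false]
      refine List.count_eq_zero.2 fun h => hx ?_
      obtain ⟨q', -, h⟩ := List.mem_map.1 h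
      exact congrArg Prod.fst h

/-- The labels of the positions of a word of length `n`, for an occurrence that starts at `a`. -/
def paddedLabels (p : List V) (n a : ℕ) (ℓ : V → ℕ) : List (Option (V × ℕ)) :=
  List.replicate a none ++ (labels p ℓ).map some ++
    List.replicate (n - (a + (labels p ℓ).length)) none

omit [DecidableEq V] in
theorem length_paddedLabels {p : List V} {n a : ℕ} {ℓ : V → ℕ}
    (h : a + (labels p ℓ).length ≤ n) : (paddedLabels p n a ℓ).length = n := by
  simp only [paddedLabels, List.length_append, List.length_replicate, List.length_map]
  omega

theorem count_paddedLabels (p : List V) (n a : ℕ) (ℓ : V → ℕ) {v : V} {q : ℕ} (hq : q < ℓ v) :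
    (paddedLabels p n a ℓ).count (some (v, q)) = p.count v := by
  rw [paddedLabels, List.count_append, List.count_append,
    List.count_map_of_injective _ _ (Option.some_injective _), count_labels p ℓ hq]
  simp [List.count_replicate]

/-- The positions with label `c`. -/
abbrev LabelFiber (p : List V) (n a : ℕ) (ℓ : V → ℕ) (c : V × ℕ) : Type :=
  {t : Fin n // (paddedLabels p n a ℓ)[t.1]? = some (some c)}

theorem card_labelFiber {p : List V} {n a : ℕ} {ℓ : V → ℕ} (h : a + (labels p ℓ).length ≤ n)
    {v : V} {q : ℕ} (hq : q < ℓ v) :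
    Fintype.card (LabelFiber p n a ℓ (v, q)) = p.count v := by
  rw [← count_paddedLabels p n a ℓ hq]
  convert card_getElem?_eq_some (length_paddedLabels h) (some (v, q)) using 1
  exact congrArg (fun b => @List.count _ b _ _) (lawful_beq_subsingleton _ _)

/-- `w` encounters `p` at position `a`, the variable `v` having an image of length `ℓ v`. -/
def EncountersAt {A : Type*} (p : List V) (n a : ℕ) (ℓ : V → ℕ) (w : Fin n → Option A) : Prop :=
  ∀ c, ConstUpToHoles fun t : LabelFiber p n a ℓ c => w t.1

omit [DecidableEq V] in
theorem PartialWord.Encounters.exists_encountersAt {A : Type*} [Nonempty A] {p : List V} {n : ℕ}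
    {w : Fin n → Option A} (h : PartialWord.Encounters (List.ofFn w) p) :
    ∃ (a : ℕ) (ℓ : V → ℕ), (∀ v, 1 ≤ ℓ v) ∧ a + (labels p ℓ).length ≤ n ∧
      EncountersAt p n a ℓ w := by
  classical
  obtain ⟨φ, hφ, f, ⟨pre, post, hw⟩, hc⟩ := h
  -- `ψ c` is the letter at which the class of `c` is constant. The default is reached only for
  -- indices beyond the image, whose classes are empty.
  let ψ : V × ℕ → A := fun c => (φ c.1).getD c.2 (Classical.arbitrary A)
  let ℓ : V → ℕ := fun v => (φ v).length
  have hlab : p.flatMap φ = (labels p ℓ).map ψ := by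
    rw [labels, List.map_flatMap]
    refine List.flatMap_congr fun v _ => ?_
    rw [List.map_map]
    refine List.ext_getElem (by simp [ℓ]) fun i h1 h2 => ?_
    simp [ψ, h1]
  have hlen : (labels p ℓ).length = f.length := by
    have := hc.length_eq
    rw [hlab] at this
    simpa using this.symm
  have hn : n = pre.length + f.length + post.length := by
    have := congrArg List.length hw
    simp at this
    omega
  refine ⟨pre.length, ℓ, fun v => List.length_pos_iff.2 (hφ v), by omega, fun c => ⟨ψ c, ?_⟩⟩
  -- An unlabelled position is unconstrained, so `R` extends from the factor to the whole word.
  let R : Option A → Option (V × ℕ) → Prop := fun o l => ∀ c ∈ l, o = none ∨ o = some (ψ c)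
  have hnone : ∀ l : List (Option A), List.Forall₂ R l (List.replicate l.length none) := by
    intro l
    induction l with
    | nil => simp
    | cons x l ih => exact List.Forall₂.cons (by simp [R]) ih
  have hmid : List.Forall₂ R f ((labels p ℓ).map some) := by
    rw [PartialWord.Compatible, hlab, List.map_map, List.forall₂_map_right_iff] at hc
    rw [List.forall₂_map_right_iff]
    refine hc.imp fun o c' h c hcc => ?_
    obtain rfl : c' = c := by simpa using hcc
    cases o with
    | none => exact Or.inl rfl
    | some x => exact Or.inr (congrArg some (h x rfl (ψ c') rfl))
  have hall : List.Forall₂ R (List.ofFn w) (paddedLabels p n pre.length ℓ) := by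
    rw [← hw, paddedLabels, show n - (pre.length + (labels p ℓ).length) = post.length by omega]
    exact List.rel_append (List.rel_append (hnone pre) hmid) (hnone post)
  rintro ⟨t, ht⟩
  obtain ⟨ht1, ht2⟩ := List.getElem?_eq_some_iff.1 ht
  have := (List.forall₂_iff_get.1 hall).2 t.1 (by simp) ht1
  simp only [List.get_eq_getElem, ht2, List.getElem_ofFn] at this
  exact this c rfl

/-- The probability that `k` independent characters are constant up to holes. -/
noncomputable def constProb (m : ℕ) (d : ℝ) (k : ℕ) : ℝ :=
  d ^ k + m * ((d + (1 - d) / m) ^ k - d ^ k)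

-- Only the classes of variables in `τ` are retained; dropping the other conditions enlarges the
-- set. Hence the loss involves only the positions occupied by `τ`, as the union bound requires.
open Classical in
theorem card_encountersAt_le {A : Type*} [Fintype A] [DecidableEq A] [Nonempty A] {p : List V} {n a h : ℕ}
    {ℓ : V → ℕ} (h0 : 0 < h) (hn : h < n) (hlen : a + (labels p ℓ).length ≤ n)
    (hℓ : ∀ v, 1 ≤ ℓ v) {τ : Finset V} (hτ : τ.Nonempty) (hτp : τ ⊆ p.toFinset) :
    (#{w ∈ wordsWithHoles (Fin n) A h | EncountersAt p n a ℓ w} : ℝ) *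
        (n + 1 - (∑ v ∈ τ, p.count v * ℓ v : ℕ)) ≤
      #(wordsWithHoles (Fin n) A h) * n *
        ∏ v ∈ τ, constProb (Fintype.card A) ((h : ℝ) / n) (p.count v) ^ ℓ v := by
  let C := Σ v : τ, Fin (ℓ v)
  let F : C → Type := fun c => LabelFiber p n a ℓ (c.1, c.2)
  have hF : ∀ c : C, Fintype.card (F c) = p.count c.1.1 := fun c =>
    card_labelFiber hlen c.2.2
  -- The classes are disjoint because each position carries at most one label.
  let e : (Σ c, F c) ↪ Fin n := ⟨fun x => x.2.1, by
    rintro ⟨⟨⟨v, hv⟩, q⟩, t, ht⟩ ⟨⟨⟨v', hv'⟩, q'⟩, t', ht'⟩ (rfl : t = t')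
    have := ht.symm.trans ht'
    simp only [Option.some.injEq, Prod.mk.injEq] at this
    obtain ⟨rfl, h2⟩ := this
    obtain rfl := Fin.ext h2
    rfl⟩
  have hne : Nonempty (Σ c, F c) := by
    obtain ⟨v, hv⟩ := hτ
    have : 0 < Fintype.card (F ⟨⟨v, hv⟩, 0, hℓ v⟩) := by
      rw [hF]
      exact List.count_pos_iff.2 (List.mem_toFinset.1 (hτp hv))
    obtain ⟨t⟩ := Fintype.card_pos_iff.1 this
    exact ⟨⟨_, t⟩⟩
  have hcard : Fintype.card (Σ c, F c) = ∑ v ∈ τ, p.count v * ℓ v := by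
    rw [Fintype.card_sigma]
    simp_rw [hF]
    rw [Fintype.sum_sigma, ← Finset.sum_coe_sort τ]
    simp [mul_comm]
  have key := card_words_constUpToHoles_le (T := Fin n) (A := A) h0 (by simpa using hn) e hne
  rw [hcard] at key
  simp only [Fintype.card_fin] at key
  have hd : (h : ℝ) / n ≤ 1 := by
    rw [div_le_one (by exact_mod_cast h0.trans hn)]; exact_mod_cast hn.le
  have hLn : ∑ v ∈ τ, p.count v * ℓ v ≤ n := by
    rw [← hcard]
    simpa using Fintype.card_le_of_embedding e
  refine (mul_le_mul_of_nonneg_right ?_ ?_).trans (key.trans (mul_le_mul_of_nonneg_left ?_ ?_))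
  · rw [Nat.cast_le]
    refine Finset.card_le_card fun w hw => ?_
    rw [Finset.mem_filter] at hw ⊢
    exact ⟨hw.1, fun c => hw.2 _⟩
  · have : ((∑ v ∈ τ, p.count v * ℓ v : ℕ) : ℝ) ≤ n := by exact_mod_cast hLn
    linarith
  · calc _ ≤ ∏ c : C, constProb (Fintype.card A) ((h : ℝ) / n) (p.count c.1.1) := by
          refine Finset.prod_le_prod (fun c _ => ?_) fun c _ => ?_
          · refine Finset.sum_nonneg fun v _ => Finset.prod_nonneg fun i _ => ?_
            have : 0 ≤ 1 - (h : ℝ) / n := by linarith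
            cases v i <;> simp only [charWeight] <;> positivity
          · refine (sum_constUpToHoles_le (by positivity) hd).trans_eq ?_
            rw [hF, constProb]
      _ = _ := by
          rw [Fintype.prod_sigma, ← Finset.prod_coe_sort τ]
          simp
  · positivity

end Labels

/-! ### The union bound and the existence of avoiding words. -/

section Main

open Finset

theorem constProb_eq_patternQ_div {m : ℕ} (hm : 1 ≤ m) (d : ℚ) {k : ℕ} (hk : 1 ≤ k) :
    constProb m d k = patternQ m d k / (m : ℝ) ^ (k - 1) := by
  have hm0 : (m : ℝ) ≠ 0 := by positivity
  obtain ⟨k, rfl⟩ := Nat.exists_eq_add_of_le' hk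
  have e : (d : ℝ) + (1 - d) / m = (1 + d * (m - 1)) / m := by field_simp; ring
  rw [constProb, patternQ, e, div_pow, mul_pow, Nat.add_sub_cancel, pow_succ (m : ℝ) k]
  field_simp
  ring

theorem constProb_pos {m : ℕ} {d : ℝ} (hd0 : 0 < d) (hd1 : d ≤ 1) (k : ℕ) :
    0 < constProb m d k := by
  have h : d ^ k ≤ (d + (1 - d) / m) ^ k := by
    gcongr
    have : 0 ≤ 1 - d := by linarith
    have : 0 ≤ (1 - d) / m := by positivity
    linarith
  have h' : 0 ≤ (d + (1 - d) / m) ^ k - d ^ k := by linarith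
  rw [constProb]
  positivity

/-- The value is `1` at `k = 1` and does not increase with `k`. This makes every factor of the
threshold nonnegative. -/
theorem constProb_le_one {m : ℕ} (hm : 1 ≤ m) {d : ℝ} (hd0 : 0 < d) (hd1 : d ≤ 1) {k : ℕ}
    (hk : 1 ≤ k) : constProb m d k ≤ 1 := by
  have hm0 : (0 : ℝ) < m := by exact_mod_cast hm
  have hm1 : (1 : ℝ) ≤ m := by exact_mod_cast hm
  induction k, hk using Nat.le_induction with
  | base =>
    rw [constProb]
    field_simp
    linarith
  | succ k hk ih =>
    refine le_trans ?_ ih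
    have h0 : 0 ≤ (1 - d) / m := div_nonneg (by linarith) hm0.le
    set q := d + (1 - d) / m with hq
    have hq1 : q ≤ 1 := by
      have : (1 - d) / m ≤ 1 - d := div_le_self (by linarith) hm1
      linarith
    have hdq : d ^ k ≤ q ^ k := pow_le_pow_left₀ hd0.le (by linarith) k
    have e : (m : ℝ) * (q - d) = 1 - d := by rw [hq]; field_simp; ring
    rw [constProb, constProb, ← hq, pow_succ, pow_succ]
    have : d ^ k * d + m * (q ^ k * q - d ^ k * d) =
        d ^ k * d + m * q * (q ^ k - d ^ k) + d ^ k * (1 - d) := by rw [← e]; ring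
    rw [this]
    have : (m : ℝ) * q * (q ^ k - d ^ k) ≤ m * (q ^ k - d ^ k) := by
      have : 0 ≤ (m : ℝ) * (q ^ k - d ^ k) := mul_nonneg hm0.le (by linarith)
      nlinarith
    linarith

theorem sum_Icc_pow_le {x : ℝ} (hx0 : 0 < x) (hx1 : x < 1) (n : ℕ) :
    ∑ l ∈ Icc 1 n, x ^ l ≤ (1 / x - 1)⁻¹ := by
  have h1 : 0 < 1 - x := by linarith
  have e : (1 / x - 1)⁻¹ = x / (1 - x) := by field_simp
  rw [e, le_div_iff₀ h1, Finset.sum_mul]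
  have : ∀ n : ℕ, ∑ l ∈ Icc 1 n, x ^ l * (1 - x) = x - x ^ (n + 1) := fun n => by
    induction n with
    | zero => simp
    | succ n ih => rw [Finset.sum_Icc_succ_top (by omega), ih]; ring
  rw [this]
  have : 0 < x ^ (n + 1) := by positivity
  linarith

theorem countP_ofFn {A : Type*} {n : ℕ} (w : Fin n → A) (P : A → Bool) :
    (List.ofFn w).countP P = #{t | P (w t) = true} := by
  induction n with
  | zero => simp
  | succ n ih =>
    rw [List.ofFn_succ, List.countP_cons, ih, Fin.card_filter_univ_succ]
    split_ifs <;> simp_all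

theorem holeDensity_ofFn {A : Type*} [Fintype A] [DecidableEq A] {n h : ℕ} {w : Fin n → Option A}
    (hw : w ∈ wordsWithHoles (Fin n) A h) :
    PartialWord.holeDensity (List.ofFn w) = (h : ℚ) / n := by
  rw [PartialWord.holeDensity, countP_ofFn, List.length_ofFn, ← mem_wordsWithHoles.1 hw]
  simp

variable {V : Type*} [DecidableEq V]

/-- The lengths of the images of the variables of `p`, given separately for the single variables
and for the others. -/
def glueLengths (σ τ : Finset V) (g : Option σ → ℕ) (l : τ → ℕ) (v : V) : ℕ :=
  if h : v ∈ τ then l ⟨v, h⟩ else if h : v ∈ σ then g (some ⟨v, h⟩) else 1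

open Classical in
/-- The number of words with `h` holes that encounter `p`, by the union bound. -/
theorem card_encounters_le {A : Type*} [Fintype A] [DecidableEq A] [Nonempty A] {p : List V} {n h : ℕ}
    (h0 : 0 < h) (hn : h < n) {σ τ : Finset V} (hστ : Disjoint σ τ) (hp : σ ∪ τ = p.toFinset)
    (hσ : ∀ v ∈ σ, p.count v = 1) (hτ : τ.Nonempty) :
    (#{w ∈ wordsWithHoles (Fin n) A h | PartialWord.Encounters (List.ofFn w) p} : ℝ) ≤
      #(wordsWithHoles (Fin n) A h) * ((n : ℝ) ^ (#σ + 1) / (#σ + 1).factorial *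
        ∏ v ∈ τ, ∑ l ∈ Icc 1 n, constProb (Fintype.card A) ((h : ℝ) / n) (p.count v) ^ l) := by
  set W := wordsWithHoles (Fin n) A h with hW
  set x : V → ℝ := fun v => constProb (Fintype.card A) ((h : ℝ) / n) (p.count v) with hx
  have hn0 : (0 : ℝ) < n := by exact_mod_cast h0.trans hn
  have hx0 : ∀ v, 0 < x v := fun v => constProb_pos (by positivity)
    (by rw [div_le_one hn0]; exact_mod_cast hn.le) _
  have hτp : τ ⊆ p.toFinset := hp ▸ Finset.subset_union_right
  let L : (τ → ℕ) → ℕ := fun l => ∑ v : τ, p.count v.1 * l v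
  let Ls : Finset (τ → ℕ) := Fintype.piFinset fun _ => Icc 1 n
  -- The coordinate `none` stores the start plus one, so that all `#σ + 1` coordinates are positive
  -- and the bound on their total becomes `n + 1 - L l`.
  let P : (τ → ℕ) → Finset (Option σ → ℕ) := fun l =>
    {g ∈ Fintype.piFinset fun _ => Icc 1 (n + 1) | ∑ o, g o + L l ≤ n + 1}
  let E : (τ → ℕ) → (Option σ → ℕ) → Finset (Fin n → Option A) := fun l g =>
    {w ∈ W | EncountersAt p n (g none - 1) (glueLengths σ τ g l) w}
  have hlen : ∀ g l, (labels p (glueLengths σ τ g l)).length = ∑ v : σ, g (some v) + L l := by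
    intro g l
    rw [length_labels, ← hp, Finset.sum_union hστ, ← Finset.sum_coe_sort σ,
      ← Finset.sum_coe_sort τ]
    congr 1
    · refine Finset.sum_congr rfl fun v _ => ?_
      rw [hσ v v.2, glueLengths, dif_neg (Finset.disjoint_left.1 hστ v.2), dif_pos v.2, one_mul]
    · refine Finset.sum_congr rfl fun v _ => ?_
      rw [glueLengths, dif_pos v.2]
  have hcover : ({w ∈ W | PartialWord.Encounters (List.ofFn w) p} : Finset _) ⊆
      Ls.biUnion fun l => (P l).biUnion fun g => E l g := by
    intro w hw
    obtain ⟨hwW, hwE⟩ := Finset.mem_filter.1 hw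
    obtain ⟨a, ℓ, hℓ, hal, hat⟩ := hwE.exists_encountersAt
    let l : τ → ℕ := fun v => ℓ v
    let g : Option σ → ℕ := fun o => o.elim (a + 1) fun v => ℓ v
    have hlab : labels p ℓ = labels p (glueLengths σ τ g l) := by
      refine labels_congr fun v hv => ?_
      have hv' := List.mem_toFinset.2 hv
      rw [← hp, Finset.mem_union] at hv'
      rw [glueLengths]
      split_ifs with h1 h2
      · rfl
      · rfl
      · exact absurd hv' (by tauto)
    have hsum : a + (∑ v : σ, g (some v) + L l) ≤ n := by rw [← hlen, ← hlab]; exact hal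
    have hcount : ∀ v ∈ τ, 1 ≤ p.count v := fun v hv =>
      List.count_pos_iff.2 (List.mem_toFinset.1 (hτp hv))
    simp only [Finset.mem_biUnion]
    refine ⟨l, ?_, g, ?_, ?_⟩
    · refine Fintype.mem_piFinset.2 fun v => Finset.mem_Icc.2 ⟨hℓ _, ?_⟩
      have h1 : p.count v.1 * l v ≤ L l :=
        Finset.single_le_sum (f := fun v : τ => p.count v.1 * l v) (fun _ _ => Nat.zero_le _)
          (Finset.mem_univ v)
      have := Nat.le_mul_of_pos_left (l v) (hcount v v.2)
      omega
    · have hgs : ∑ o, g o + L l ≤ n + 1 := by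
        rw [Fintype.sum_option]
        change a + 1 + _ + _ ≤ _
        omega
      refine Finset.mem_filter.2 ⟨Fintype.mem_piFinset.2 fun o => Finset.mem_Icc.2 ⟨?_, ?_⟩, hgs⟩
      · cases o with
        | none => exact Nat.succ_le_succ (Nat.zero_le a)
        | some v => exact hℓ _
      · have := Finset.single_le_sum (f := g) (fun _ _ => Nat.zero_le _) (Finset.mem_univ o)
        omega
    · refine Finset.mem_filter.2 ⟨hwW, ?_⟩
      have hpad : paddedLabels p n (g none - 1) (glueLengths σ τ g l) = paddedLabels p n a ℓ := by
        rw [paddedLabels, paddedLabels, hlab]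
        rfl
      rintro c
      obtain ⟨b, hb⟩ := hat c
      exact ⟨b, fun t => hb ⟨t.1, hpad ▸ t.2⟩⟩
  have hE : ∀ l ∈ Ls, ∀ g ∈ P l,
      (#(E l g) : ℝ) * (n + 1 - L l : ℕ) ≤ #W * n * ∏ v : τ, x v ^ l v := by
    intro l hl g hg
    obtain ⟨hg1, hg2⟩ := Finset.mem_filter.1 hg
    have hg1' : ∀ o, 1 ≤ g o := fun o => (Finset.mem_Icc.1 (Fintype.mem_piFinset.1 hg1 o)).1
    have hl' : ∀ v, 1 ≤ l v := fun v => (Finset.mem_Icc.1 (Fintype.mem_piFinset.1 hl v)).1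
    rw [Fintype.sum_option] at hg2
    have hg0 := hg1' none
    have hglue : ∀ v : τ, glueLengths σ τ g l v = l v := fun v => dif_pos v.2
    have key := card_encountersAt_le (A := A) (p := p) (a := g none - 1)
      (ℓ := glueLengths σ τ g l) h0 hn (by rw [hlen]; omega) (fun v => by
        rw [glueLengths]
        split_ifs
        exacts [hl' _, hg1' _, le_rfl]) hτ hτp
    rw [← Finset.sum_coe_sort τ, ← Finset.prod_coe_sort τ] at key
    simp only [hglue] at key
    rw [Nat.cast_sub (by omega)]
    push_cast [L] at key ⊢
    exact key
  have hP : ∀ l ∈ Ls, ∑ g ∈ P l, (#(E l g) : ℝ) ≤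
      #W * ((n : ℝ) ^ (#σ + 1) / (#σ + 1).factorial * ∏ v : τ, x v ^ l v) := by
    intro l hl
    have hl' : ∀ v, 1 ≤ l v := fun v => (Finset.mem_Icc.1 (Fintype.mem_piFinset.1 hl v)).1
    have hprod : 0 < ∏ v : τ, x v ^ l v := Finset.prod_pos fun v _ => pow_pos (hx0 v) _
    rcases (P l).eq_empty_or_nonempty with hPe | ⟨g, hg⟩
    · rw [hPe, Finset.sum_empty]; positivity
    have hM : 0 < n + 1 - L l := by
      obtain ⟨hg1, hg2⟩ := Finset.mem_filter.1 hg
      have := (Finset.mem_Icc.1 (Fintype.mem_piFinset.1 hg1 none)).1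
      rw [Fintype.sum_option] at hg2
      omega
    have hL : 0 < L l := by
      obtain ⟨v, hv⟩ := hτ
      refine Finset.sum_pos (fun v _ => Nat.mul_pos ?_ (hl' v)) ⟨⟨v, hv⟩, Finset.mem_univ _⟩
      exact List.count_pos_iff.2 (List.mem_toFinset.1 (hτp v.2))
    have hcard : #(P l) ≤ (n + 1 - L l).choose (#σ + 1) := by
      have := card_functions_sum_le (n + 1 - L l) (P l) fun g hg => by
        obtain ⟨hg1, hg2⟩ := Finset.mem_filter.1 hg
        exact ⟨fun o => (Finset.mem_Icc.1 (Fintype.mem_piFinset.1 hg1 o)).1, by omega⟩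
      simpa using this
    have hcount : #(P l) * n * (#σ + 1).factorial ≤ n ^ (#σ + 1) * (n + 1 - L l) :=
      le_trans (by gcongr) (choose_mul_factorial_le hL)
    have hcount' : (#(P l) : ℝ) * n * (#σ + 1).factorial ≤
        (n : ℝ) ^ (#σ + 1) * (n + 1 - L l : ℕ) := by exact_mod_cast hcount
    have hM' : (0 : ℝ) < (n + 1 - L l : ℕ) := by exact_mod_cast hM
    -- Multiplying by `n + 1 - L l` brings in the loss from `hE`, which `hcount'` then cancels.
    refine le_of_mul_le_mul_right ?_ hM'
    rw [Finset.sum_mul]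
    refine (Finset.sum_le_sum (hE l hl)).trans ?_
    rw [Finset.sum_const, nsmul_eq_mul]
    have hf : (0 : ℝ) < (#σ + 1).factorial := by positivity
    calc _ = #W * (∏ v : τ, x v ^ l v) * (#(P l) * n * (#σ + 1).factorial) /
          (#σ + 1).factorial := by field_simp
      _ ≤ #W * (∏ v : τ, x v ^ l v) * ((n : ℝ) ^ (#σ + 1) * (n + 1 - L l : ℕ)) /
          (#σ + 1).factorial := by gcongr
      _ = _ := by ring
  calc (#{w ∈ W | PartialWord.Encounters (List.ofFn w) p} : ℝ)
      ≤ (∑ l ∈ Ls, ∑ g ∈ P l, #(E l g) : ℕ) := by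
        rw [Nat.cast_le]
        exact (Finset.card_le_card hcover).trans (Finset.card_biUnion_le.trans
          (Finset.sum_le_sum fun l _ => Finset.card_biUnion_le))
    _ = ∑ l ∈ Ls, ∑ g ∈ P l, (#(E l g) : ℝ) := by push_cast; rfl
    _ ≤ ∑ l ∈ Ls, #W * ((n : ℝ) ^ (#σ + 1) / (#σ + 1).factorial * ∏ v : τ, x v ^ l v) :=
        Finset.sum_le_sum hP
    _ = _ := by
        rw [← Finset.mul_sum, ← Finset.mul_sum, ← Finset.prod_coe_sort τ, Finset.prod_univ_sum]

omit [DecidableEq V] in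
theorem length_le_of_encounters {A : Type*} {w : PartialWord A} {p : List V}
    (h : w.Encounters p) : p.length ≤ w.length := by
  obtain ⟨φ, hφ, f, hf, hc⟩ := h
  refine le_trans ?_ hf.length_le
  rw [hc.length_eq, List.length_map, List.length_flatMap]
  calc p.length = (p.map fun _ => 1).sum := by simp
    _ ≤ _ := List.sum_le_sum fun v _ => List.length_pos_iff.2 (hφ v)

theorem factorial_succ_le_pow {s n : ℕ} (hs : s ≤ n) (hn : 2 ≤ n) :
    (s + 1).factorial ≤ n ^ (s + 1) := by
  rcases Nat.lt_or_ge s 2 with h | h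
  · have h2 : (s + 1).factorial ≤ 2 ^ (s + 1) := by interval_cases s <;> decide
    exact h2.trans (Nat.pow_le_pow_left hn _)
  · refine le_trans ?_ (Nat.pow_le_pow_left hs _)
    clear hs hn
    induction s, h using Nat.le_induction with
    | base => decide
    | succ s hs ih =>
      -- The step rests on `(s + 2) * s ≤ (s + 1) ^ 2`. The bound `(s + 1)! ≤ s ^ (s + 1)` fails at
      -- `s = 1`, hence the separate small cases.
      rw [Nat.factorial_succ]
      calc (s + 1 + 1) * (s + 1).factorial ≤ (s + 1 + 1) * s ^ (s + 1) := by gcongr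
        _ = (s + 1 + 1) * s * s ^ s := by ring
        _ ≤ (s + 1) ^ 2 * (s + 1) ^ s := by
          gcongr
          · nlinarith
          · omega
        _ = _ := by ring

theorem exists_avoiding_of_lt_avoidThreshold {m : ℕ} (hm : 1 ≤ m) {d : ℚ} (hd0 : 0 < d)
    (hd1 : d < 1) {p : List V} {n : ℕ} (hn0 : 0 < n) (hd : ∃ h : ℕ, (h : ℚ) = d * n)
    (hlt : (n : ℝ) < avoidThreshold m d p) :
    ∃ w : PartialWord (Fin m), w.length = n ∧ w.holeDensity = d ∧ w.Avoids p := by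
  classical
  obtain ⟨h, hh⟩ := hd
  have hnQ : (0 : ℚ) < n := by exact_mod_cast hn0
  have h0 : 0 < h := by
    have : (0 : ℚ) < h := hh ▸ mul_pos hd0 hnQ
    exact_mod_cast this
  have hn : h < n := by
    have : (h : ℚ) < n := by rw [hh]; nlinarith
    exact_mod_cast this
  have hdQ : (h : ℚ) / n = d := by rw [hh]; field_simp
  have hdR : (h : ℝ) / n = d := by rw [← hdQ]; push_cast; rfl
  have : Nonempty (Fin m) := ⟨⟨0, hm⟩⟩
  have hW : 0 < #(wordsWithHoles (Fin n) (Fin m) h) := by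
    rw [card_wordsWithHoles]
    have : 0 < (Fintype.card (Fin n)).choose h := Nat.choose_pos (by simpa using hn.le)
    have : 0 < Fintype.card (Fin m) := Fintype.card_pos
    positivity
  suffices hs : ∃ w ∈ wordsWithHoles (Fin n) (Fin m) h,
      ¬ PartialWord.Encounters (List.ofFn w) p by
    obtain ⟨w, hw, hwp⟩ := hs
    exact ⟨List.ofFn w, List.length_ofFn, (holeDensity_ofFn hw).trans hdQ, hwp⟩
  have hd0' : (0 : ℝ) < d := by exact_mod_cast hd0
  have hd1' : (d : ℝ) ≤ 1 := by exact_mod_cast hd1.le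
  set σ := p.toFinset.filter fun v => p.count v = 1 with hσ
  set τ := p.toFinset.filter fun v => 2 ≤ p.count v with hτ
  set y : V → ℝ := fun v => 1 / constProb m d (p.count v) - 1 with hy
  have hprod : ∏ v ∈ τ, ((m : ℝ) ^ (p.count v - 1) / patternQ m d (p.count v) - 1) =
      ∏ v ∈ τ, y v := by
    refine Finset.prod_congr rfl fun v hv => ?_
    have := (Finset.mem_filter.1 hv).2
    rw [hy]
    simp only
    rw [constProb_eq_patternQ_div hm d (by omega), one_div_div]
  have hy0 : ∀ v ∈ τ, 0 ≤ y v := fun v hv => by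
    have := (Finset.mem_filter.1 hv).2
    have h1 := constProb_le_one hm hd0' hd1' (k := p.count v) (by omega)
    have := one_le_one_div (constProb_pos (m := m) hd0' hd1' (p.count v)) h1
    simp only [hy]
    linarith
  have hlt' : (n : ℝ) ^ (#σ + 1) < (#σ + 1).factorial * ∏ v ∈ τ, y v := by
    rw [avoidThreshold, ← hτ, hprod, numSingle, ← hσ] at hlt
    have hB : 0 ≤ ((#σ + 1).factorial : ℝ) * ∏ v ∈ τ, y v :=
      mul_nonneg (by positivity) (Finset.prod_nonneg hy0)
    have := pow_lt_pow_left₀ hlt (by positivity) (n := #σ + 1) (by omega)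
    have e : (1 / ((#σ : ℝ) + 1)) = ((#σ + 1 : ℕ) : ℝ)⁻¹ := by push_cast; rw [one_div]
    rwa [e, Real.rpow_inv_natCast_pow hB (by omega)] at this
  -- The strict hypothesis excludes a vanishing product, so each `constProb` is below `1` and the
  -- geometric series converge.
  have hpos : 0 < ∏ v ∈ τ, y v := by
    refine (Finset.prod_nonneg hy0).lt_of_ne fun h => ?_
    rw [← h, mul_zero] at hlt'
    exact absurd hlt' (not_lt.2 (by positivity))
  have hy1 : ∀ v ∈ τ, 0 < y v := fun v hv =>
    (hy0 v hv).lt_of_ne fun h => hpos.ne' (Finset.prod_eq_zero hv h.symm)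
  have hστ : Disjoint σ τ := Finset.disjoint_left.2 fun v h1 h2 => by
    have := (Finset.mem_filter.1 h1).2
    have := (Finset.mem_filter.1 h2).2
    omega
  have hp : σ ∪ τ = p.toFinset := by
    ext v
    simp only [hσ, hτ, Finset.mem_union, Finset.mem_filter, List.mem_toFinset]
    constructor
    · tauto
    · intro hv
      have := List.count_pos_iff.2 hv
      by_cases h1 : p.count v = 1
      · exact Or.inl ⟨hv, h1⟩
      · exact Or.inr ⟨hv, by omega⟩
  by_contra! hall
  -- Without repeated variables there is no class to estimate. Here length decides: an encounter
  -- forces `#σ ≤ n`, and then `(#σ + 1)! ≤ n ^ (#σ + 1)` contradicts the hypothesis.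
  rcases τ.eq_empty_or_nonempty with hτe | hτn
  · rw [hτe, Finset.prod_empty, mul_one] at hlt'
    have hlt'' : n ^ (#σ + 1) < (#σ + 1).factorial := by exact_mod_cast hlt'
    obtain ⟨w, hw⟩ := Finset.card_pos.1 hW
    have h1 := length_le_of_encounters (hall w hw)
    rw [List.length_ofFn] at h1
    have h2 : #σ ≤ p.length := by
      rw [← Finset.union_empty σ, ← hτe, hp]
      exact List.toFinset_card_le p
    have h3 : #σ ≤ n := h2.trans h1
    have h4 : 2 ≤ n := by omega
    have h5 := factorial_succ_le_pow h3 h4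
    omega
  · have key := card_encounters_le (A := Fin m) (p := p) h0 hn hστ hp
      (fun v hv => (Finset.mem_filter.1 hv).2) hτn
    rw [Finset.filter_true_of_mem hall, hdR, Fintype.card_fin] at key
    have hle : ∏ v ∈ τ, ∑ l ∈ Icc 1 n, constProb m d (p.count v) ^ l ≤ (∏ v ∈ τ, y v)⁻¹ := by
      rw [← Finset.prod_inv_distrib]
      refine Finset.prod_le_prod (fun v _ => Finset.sum_nonneg fun l _ =>
        (pow_pos (constProb_pos hd0' hd1' _) _).le) fun v hv => ?_
      have hc := constProb_pos (m := m) hd0' hd1' (p.count v)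
      refine sum_Icc_pow_le hc ?_ n
      have := hy1 v hv
      simp only [hy, sub_pos] at this
      rwa [lt_div_iff₀ hc, one_mul] at this
    have hlt1 : (n : ℝ) ^ (#σ + 1) / (#σ + 1).factorial *
        ∏ v ∈ τ, ∑ l ∈ Icc 1 n, constProb m d (p.count v) ^ l < 1 := by
      refine (mul_le_mul_of_nonneg_left hle (by positivity)).trans_lt ?_
      rw [← div_eq_mul_inv, div_div, div_lt_one (by positivity)]
      exact hlt'
    have hW' : (0 : ℝ) < #(wordsWithHoles (Fin n) (Fin m) h) := by exact_mod_cast hW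
    exact absurd key (not_le.2 (mul_lt_of_lt_one_right hW' hlt1))

/-! ### Zimin patterns and the Ramsey length. -/

theorem count_zimin {i v : ℕ} (hv : 1 ≤ v) :
    (zimin i).count v = if v ≤ i then 2 ^ (i - v) else 0 := by
  induction i with
  | zero => rw [if_neg (by omega)]; rfl
  | succ i ih =>
    rw [zimin, List.count_append, List.count_append, ih]
    rcases lt_trichotomy v (i + 1) with h | h | h
    · rw [if_pos (by omega), if_pos (by omega), List.count_singleton, if_neg (by simp; omega),
        show i + 1 - v = i - v + 1 by omega, pow_succ]
      ring
    · subst h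
      simp
    · rw [if_neg (by omega), if_neg (by omega), List.count_singleton, if_neg (by simp; omega)]

theorem toFinset_zimin (i : ℕ) : (zimin i).toFinset = Icc 1 i := by
  induction i with
  | zero => rfl
  | succ i ih =>
    rw [zimin, List.toFinset_append, List.toFinset_append, ih]
    ext v
    simp
    omega

theorem avoidThreshold_zimin (m : ℕ) (d : ℚ) {i : ℕ} (hi : 1 ≤ i) :
    avoidThreshold m d (zimin i) = Real.sqrt (2 * ∏ j ∈ Finset.Icc 1 (i - 1),
      ((m : ℝ) ^ (2 ^ j - 1) / patternQ m d (2 ^ j) - 1)) := by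
  have hcount : ∀ v ∈ Icc 1 i, (zimin i).count v = 2 ^ (i - v) := fun v hv => by
    rw [Finset.mem_Icc] at hv
    rw [count_zimin hv.1, if_pos hv.2]
  have hs : numSingle (zimin i) = 1 := by
    rw [numSingle, toFinset_zimin, Finset.card_eq_one]
    refine ⟨i, ?_⟩
    ext v
    rw [Finset.mem_filter, Finset.mem_singleton]
    constructor
    · rintro ⟨hv, h1⟩
      rw [hcount v hv] at h1
      have := (Nat.pow_eq_one.1 h1).resolve_left (by norm_num)
      rw [Finset.mem_Icc] at hv
      omega
    · rintro rfl
      have hv : v ∈ Icc 1 v := Finset.mem_Icc.2 ⟨hi, le_rfl⟩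
      exact ⟨hv, by rw [hcount v hv]; simp⟩
  have ht : (zimin i).toFinset.filter (fun v => 2 ≤ (zimin i).count v) = Icc 1 (i - 1) := by
    rw [toFinset_zimin]
    ext v
    rw [Finset.mem_filter]
    constructor
    · rintro ⟨hv, h1⟩
      rw [hcount v hv] at h1
      rw [Finset.mem_Icc] at hv ⊢
      have : v ≠ i := by rintro rfl; simp at h1
      omega
    · intro hv
      rw [Finset.mem_Icc] at hv
      have hv' : v ∈ Icc 1 i := Finset.mem_Icc.2 (by omega)
      refine ⟨hv', ?_⟩
      rw [hcount v hv']
      exact Nat.le_self_pow (by omega) 2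
  rw [avoidThreshold, hs, ht, Real.sqrt_eq_rpow]
  norm_num
  congr 2
  -- The variable `v` occurs `2 ^ (i - v)` times, so the product is reindexed by `j = i - v`.
  refine Finset.prod_bij' (fun v _ => i - v) (fun v _ => i - v) ?_ ?_ ?_ ?_ ?_
  · intro v hv; rw [Finset.mem_Icc] at hv ⊢; omega
  · intro v hv; rw [Finset.mem_Icc] at hv ⊢; omega
  · intro v hv; rw [Finset.mem_Icc] at hv; omega
  · intro v hv; rw [Finset.mem_Icc] at hv; omega
  · intro v hv
    rw [Finset.mem_Icc] at hv
    rw [hcount v (Finset.mem_Icc.2 (by omega))]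

theorem avoidThreshold_le_partialRamseyLength {m : ℕ} (hm : 1 ≤ m) {d : ℚ} (hd0 : 0 < d)
    (hd1 : d < 1) (p : List V) :
    ENNReal.ofReal (avoidThreshold m d p) ≤ (partialRamseyLength d m p : ENNReal) := by
  rw [partialRamseyLength]
  rcases Set.eq_empty_or_nonempty {N : ℕ∞ | ∃ n : ℕ, N = n ∧
    (∃ w : PartialWord (Fin m), w.length = n ∧ w.holeDensity = d) ∧
    ∀ w : PartialWord (Fin m), w.length = n → w.holeDensity = d → w.Encounters p} with he | hne
  · rw [he, sInf_empty]; simp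
  · obtain ⟨n, hN, ⟨w, hw, hwd⟩, hall⟩ := csInf_mem hne
    rw [hN, ENat.toENNReal_coe, ENNReal.ofReal_le_natCast]
    by_contra! hlt
    -- The empty word has density `0` by convention, which differs from `d`.
    have hn0 : n ≠ 0 := by
      rintro rfl
      rw [PartialWord.holeDensity, hw] at hwd
      simp at hwd
      exact hd0.ne hwd
    -- The hole count of the given word `w` shows that `d * n` is an integer.
    obtain ⟨w', h1, h2, h3⟩ := exists_avoiding_of_lt_avoidThreshold hm hd0 hd1
      (Nat.pos_of_ne_zero hn0) ⟨w.countP fun c => c.isNone, by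
        rw [← hwd, PartialWord.holeDensity, hw]
        field_simp⟩ hlt
    exact h3 (hall w' h1 h2)

end Main

theorem mainTheorem9 {V : Type*} [DecidableEq V] (m : ℕ) (hm : 1 ≤ m)
    (d : ℚ) (hd0 : 0 < d) (hd1 : d < 1) :
    (∀ (p : List V) (n : ℕ), 0 < n → (∃ h : ℕ, (h : ℚ) = d * n) →
      (n : ℝ) < avoidThreshold m d p →
      ∃ w : PartialWord (Fin m), w.length = n ∧ w.holeDensity = d ∧ w.Avoids p) ∧
    (∀ i : ℕ, 1 ≤ i →
      ENNReal.ofReal (Real.sqrt (2 * ∏ j ∈ Finset.Icc 1 (i - 1),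
        ((m : ℝ) ^ (2 ^ j - 1) / patternQ m d (2 ^ j) - 1))) ≤
      (partialRamseyLength d m (zimin i) : ENNReal)) := by
  refine ⟨fun p n hn hd hlt => exists_avoiding_of_lt_avoidThreshold hm hd0 hd1 hn hd hlt,
    fun i hi => ?_⟩
  rw [← avoidThreshold_zimin m d hi]
  exact avoidThreshold_le_partialRamseyLength hm hd0 hd1 _
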